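/- Let $U$ be a finite-dimensional complex vector superspace with a homogeneous basis $A=A_{\bar 0}\sqcup A_{\bar 1}$ ($A_{\bar 0}$ even, $A_{\bar 1}$ odd), and let $(t_a)_{a\in A}$ be complex numbers. Let $F^{ch}_{N=1}$ be the supersymmetric charged free fermion vertex algebra of $U$: the $N_K=1$ SUSY vertex algebra, with odd derivation $D$ and $\partial=D^2$, that is the universal enveloping SUSY vertex algebra of $\mathbb{C}[\partial,D]\otimes\operatorname{span}\{\phi_a,\phi^{\bar a}: a\in A\}$, where $\phi_a$ has the parity of $a$, $\phi^{\bar a}$ has the opposite parity, and $$[\phi_a\,{}_\Lambda\,\phi^{\bar b}]=\delta_{ab},\qquad [\phi_a\,{}_\Lambda\,\phi_b]=[\phi^{\bar a}\,{}_\Lambda\,\phi^{\bar b}]=0 .$$ For $v\in F^{ch}_{N=1}$ write $Y(v,z,\theta)=\sum_{j\in\mathbb{Z}}z^{-j-1}v_{(j|1)}+\theta\sum_{j\in\mathbb{Z}}z^{-j-1}v_{(j|0)}$, and let $uv=u_{(-1|1)}v$ be the normally ordered product. Put $$T^{ch}_{sh}=\sum_{a\in A_{\bar 0}}\big((t_a+1)\,\partial\phi_a\phi^{\bar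 a}+t_a\,\phi_a\partial\phi^{\bar a}+D\phi_aD\phi^{\bar a}\big)+\sum_{a\in A_{\bar 1}}\big(t_a\,\partial\phi_a\phi^{\bar a}+(t_a+1)\,\phi_a\partial\phi^{\bar a}+D\phi_aD\phi^{\bar a}\big),$$ $$J^{ch}_{sh}=\sum_{a\in A_{\bar 0}}\big(D\phi_a\phi^{\bar a}+t_a(D\phi_a\phi^{\bar a}+\phi_aD\phi^{\bar a})\big)+\sum_{a\in A_{\bar 1}}\big(D\phi^{\bar a}\phi_a+t_a(D\phi^{\bar a}\phi_a+\phi^{\bar a}D\phi_a)\big),$$ and $d=\sum_{a\in A}D\phi_aD\phi^{\bar a}$. Then the BRST operator $$Q=\tfrac12\big({T^{ch}_{sh}}_{(0|1)}-{J^{ch}_{sh}}_{(0|0)}\big)$$ on $F^{ch}_{N=1}$ satisfies $Q=d_{(0|1)}$ and $Q^2=0$. -/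

import Mathlib

open Polynomial
open VertexOperator (ncoeff)

noncomputable section

namespace SUSYFermion

/-! ### Parities and signs -/

/-- The Koszul sign `(-1) ^ i` of a parity `i : ZMod 2`, as a complex number. -/
def sgn (i : ZMod 2) : ℂ := (-1) ^ i.val

theorem sgn_zero : sgn 0 = 1 := by simp [sgn]

theorem sgn_one : sgn 1 = -1 := by simp [sgn, ZMod.val_one]

theorem sgn_add (i j : ZMod 2) : sgn (i + j) = sgn i * sgn j := by
  have h : ∀ i : ZMod 2, i = 0 ∨ i = 1 := by decide
  rcases h i with rfl | rfl <;> rcases h j with rfl | rfl <;>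
    simp [sgn_zero, sgn_one, CharTwo.add_self_eq_zero]

theorem sgn_mul_self (i : ZMod 2) : sgn i * sgn i = 1 := by
  fin_cases i <;> simp [sgn, ZMod.val]

section

variable {A : Type*}

/-! ### The generators

`A` is a homogeneous basis of the finite-dimensional vector superspace `U`, and `p a` is the parity
of the basis vector `a`.  -/

/-- The basis of `R = ℋ ⊗ (φ_U ⊕ φ^Ū)`, where `ℋ = ℂ[∂, D]`, `D ^ 2 = ∂`, has basis `(D ^ i)`:
`(i, Sum.inl a)` is `D ^ i φ_a` and `(i, Sum.inr a)` is `D ^ i φ^ā`. -/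
abbrev Gen (A : Type*) := ℕ × (A ⊕ A)

/-- Parity of a basis vector of `R`: `φ_a` has the parity of `a`, `φ^ā` the opposite parity, and
`D` is odd. -/
def par (p : A → ZMod 2) : Gen A → ZMod 2
  | (i, Sum.inl a) => p a + i
  | (i, Sum.inr a) => p a + 1 + i

/-- The vector `D ^ m x` for a basis vector `x` of `R`. -/
def Gen.shift (m : ℕ) (x : Gen A) : Gen A := (x.1 + m, x.2)

theorem par_shift (p : A → ZMod 2) (m : ℕ) (x : Gen A) :
    par p (x.shift m) = par p x + m := by
  rcases x with ⟨i, a | a⟩ <;> simp [par, Gen.shift] <;> ring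

/-! ### The Λ-bracket of `R`

All brackets of elements of `R` are multiples of the vacuum, so they are elements
`P + χ Q` of `ℒ = ℂ[λ, χ]`, `χ ^ 2 = -λ`; these are written as pairs `(P, Q)` of polynomials in
`λ`. -/

/-- Left multiplication by `χ` : `χ (P + χ Q) = -λ Q + χ P`. -/
def chiMul (F : ℂ[X] × ℂ[X]) : ℂ[X] × ℂ[X] := (-(X * F.2), F.1)

/-- The action of `D + χ` on multiples of the vacuum, where `D` kills the vacuum and
`D χ + χ D = 2 λ` : `(D + χ) (P + χ Q) = λ Q + χ P`. -/
def dChiMul (F : ℂ[X] × ℂ[X]) : ℂ[X] × ℂ[X] := (X * F.2, F.1)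

/-- The constant brackets `[φ_a Λ φ^b̄] = δ_ab`, `[φ_a Λ φ_b] = [φ^ā Λ φ^b̄] = 0`, and
`[φ^ā Λ φ_b] = δ_ab`, which is given by skew-symmetry. -/
def pairing [DecidableEq A] : A ⊕ A → A ⊕ A → ℂ
  | Sum.inl a, Sum.inr b => if a = b then 1 else 0
  | Sum.inr a, Sum.inl b => if a = b then 1 else 0
  | _, _ => 0

/-- The bracket `[D ^ i g Λ D ^ j h]`, computed by sesquilinearity:
`[D x Λ y] = χ [x Λ y]` and `[x Λ D y] = (-1) ^ (x + 1) (D + χ) [x Λ y]`. -/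
def bracket [DecidableEq A] (p : A → ZMod 2) (g h : A ⊕ A) : ℕ → ℕ → ℂ[X] × ℂ[X]
  | i, j + 1 => sgn (par p (i, g) + 1) • dChiMul (bracket p g h i j)
  | 0, 0 => (C (pairing g h), 0)
  | i + 1, 0 => chiMul (bracket p g h i 0)

/-- The products `x_(n|k) y`, `n ≥ 0`, of basis vectors of `R`, as multiples of the vacuum:
`[x Λ y] = ∑ λ ^ n / n! x_(n|0) y + χ ∑ λ ^ n / n! x_(n|1) y`. -/
def contraction [DecidableEq A] (p : A → ZMod 2) (x y : Gen A) (n : ℕ) (k : ZMod 2) : ℂ :=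
  (n.factorial : ℂ) *
    (if k = 0 then (bracket p x.2 y.2 x.1 y.1).1 else (bracket p x.2 y.2 x.1 y.1).2).coeff n

theorem bracket_parity [DecidableEq A] (p : A → ZMod 2) (g h : A ⊕ A) (i j : ℕ) :
    (par p (i, g) + par p (j, h) ≠ 1 → (bracket p g h i j).1 = 0) ∧
      (par p (i, g) + par p (j, h) ≠ 0 → (bracket p g h i j).2 = 0) := by
  have e : ∀ (g : A ⊕ A) (i : ℕ), par p (i + 1, g) = par p (i, g) + 1 := fun g i =>
    par_shift p 1 (i, g)
  have c01 : ∀ u : ZMod 2, u + 1 ≠ 0 → u ≠ 1 := by decide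
  have c10 : ∀ u : ZMod 2, u + 1 ≠ 1 → u ≠ 0 := by decide
  induction j with
  | zero =>
    induction i with
    | zero =>
      constructor
      · intro hne
        rcases g with a | a <;> rcases h with b | b <;> simp only [bracket, pairing, map_zero]
        · split_ifs with hab
          · subst hab
            exfalso; apply hne
            simp only [par, Nat.cast_zero, add_zero]
            generalize p a = u; revert u; decide
          · simp
        · split_ifs with hab
          · subst hab
            exfalso; apply hne
            simp only [par, Nat.cast_zero, add_zero]
            generalize p a = u; revert u; decide
          · simp
      · intro _
        simp [bracket]
    | succ i ih =>
      constructor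
      · intro hne
        have := ih.2 (c10 _ (by rwa [e, add_right_comm] at hne))
        simp [bracket, chiMul, this]
      · intro hne
        have := ih.1 (c01 _ (by rwa [e, add_right_comm] at hne))
        simp [bracket, chiMul, this]
  | succ j ih =>
    constructor
    · intro hne
      have := ih.2 (c10 _ (by rwa [e, ← add_assoc] at hne))
      simp [bracket, dChiMul, this]
    · intro hne
      have := ih.1 (c01 _ (by rwa [e, ← add_assoc] at hne))
      simp [bracket, dChiMul, this]

theorem par_of_contraction_ne_zero [DecidableEq A] (p : A → ZMod 2) (x y : Gen A) (n : ℕ)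
    (k : ZMod 2) (h : contraction p x y n k ≠ 0) : par p y = par p x + k + 1 := by
  have hb := bracket_parity p x.2 y.2 x.1 y.1
  by_contra hne
  apply h
  have key : ∀ u v k : ZMod 2, v ≠ u + k + 1 → (k = 0 → u + v ≠ 1) ∧ (k ≠ 0 → u + v ≠ 0) := by
    decide
  have hk := key (par p x) (par p y) k hne
  unfold contraction
  split_ifs with h0
  · rw [hb.1 (hk.1 h0)]; simp
  · rw [hb.2 (hk.2 h0)]; simp

theorem contraction_eq_zero_of_large [DecidableEq A] (p : A → ZMod 2) (x y : Gen A)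
    (k : ZMod 2) : ∃ N, ∀ n ≥ N, contraction p x y n k = 0 := by
  refine ⟨(if k = 0 then (bracket p x.2 y.2 x.1 y.1).1
    else (bracket p x.2 y.2 x.1 y.1).2).natDegree + 1, fun n hn => ?_⟩
  unfold contraction
  rw [coeff_eq_zero_of_natDegree_lt (by omega), mul_zero]

/-! ### The underlying space -/

/-- Supercommutativity of the generators. -/
inductive Rel (p : A → ZMod 2) : FreeAlgebra ℂ (Gen A) → FreeAlgebra ℂ (Gen A) → Prop
  | comm (x y : Gen A) : Rel p (FreeAlgebra.ι ℂ x * FreeAlgebra.ι ℂ y)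
      (sgn (par p x * par p y) • (FreeAlgebra.ι ℂ y * FreeAlgebra.ι ℂ x))

/-- The underlying space of the universal enveloping supersymmetric vertex algebra of `R`: the
tensor algebra of `R` modulo `x y - (-1) ^ (x y) y x = ∫_{-∇}^0 [x Λ y] dΛ` for `x, y` in `R`. Here
`[x Λ y]` is a multiple of the vacuum, which `∂` and `D` kill, so the right hand side vanishes and
one obtains the supersymmetric algebra of `R`.  The unit is the vacuum, and left multiplication by
`x ∈ R` is the normally ordered product with `x`. -/
def Fch (p : A → ZMod 2) : Type _ := RingQuot (Rel p)

variable (p : A → ZMod 2)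

instance : Ring (Fch p) := inferInstanceAs (Ring (RingQuot (Rel p)))

instance : Algebra ℂ (Fch p) := inferInstanceAs (Algebra ℂ (RingQuot (Rel p)))

/-- The quotient map from the free algebra. -/
def Fch.mk : FreeAlgebra ℂ (Gen A) →ₐ[ℂ] Fch p := RingQuot.mkAlgHom ℂ (Rel p)

/-- The generators `D ^ i φ_a` and `D ^ i φ^ā` as vectors. -/
def gen (x : Gen A) : Fch p := Fch.mk p (FreeAlgebra.ι ℂ x)

variable {p}

theorem gen_mul_gen (x y : Gen A) :
    gen p x * gen p y = sgn (par p x * par p y) • (gen p y * gen p x) := by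
  have h : Fch.mk p (FreeAlgebra.ι ℂ x * FreeAlgebra.ι ℂ y) =
      Fch.mk p (sgn (par p x * par p y) • (FreeAlgebra.ι ℂ y * FreeAlgebra.ι ℂ x)) :=
    RingQuot.mkAlgHom_rel ℂ (Rel.comm (p := p) x y)
  rwa [map_smul, map_mul, map_mul] at h

/-- Algebra maps out of `Fch p` from supercommuting images of the generators. -/
def Fch.lift {B : Type*} [Ring B] [Algebra ℂ B] (f : Gen A → B)
    (hf : ∀ x y, f x * f y = sgn (par p x * par p y) • (f y * f x)) : Fch p →ₐ[ℂ] B :=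
  RingQuot.liftAlgHom ℂ ⟨FreeAlgebra.lift ℂ f, by
    rintro _ _ ⟨x, y⟩
    simpa using hf x y⟩

theorem Fch.lift_gen {B : Type*} [Ring B] [Algebra ℂ B] (f : Gen A → B)
    (hf : ∀ x y, f x * f y = sgn (par p x * par p y) • (f y * f x)) (x : Gen A) :
    Fch.lift f hf (gen p x) = f x := by
  unfold Fch.lift gen Fch.mk
  exact (RingQuot.liftAlgHom_mkAlgHom_apply ..).trans (by simp)

/-- Induction on monomials. -/
theorem Fch.induction (S : Submodule ℂ (Fch p)) (one : 1 ∈ S)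
    (mul : ∀ x, ∀ v ∈ S, gen p x * v ∈ S) (v : Fch p) : v ∈ S := by
  obtain ⟨a, rfl⟩ : ∃ a, Fch.mk p a = v := RingQuot.mkAlgHom_surjective ℂ (Rel p) v
  have key : ∀ w ∈ S, Fch.mk p a * w ∈ S := by
    induction a using FreeAlgebra.induction with
    | grade0 r =>
      intro w hw
      rw [AlgHom.commutes, ← Algebra.smul_def]
      exact S.smul_mem r hw
    | grade1 x => exact mul x
    | mul a b ha hb =>
      intro w hw
      rw [map_mul, mul_assoc]
      exact ha _ (hb _ hw)
    | add a b ha hb =>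
      intro w hw
      rw [map_add, add_mul]
      exact S.add_mem (ha w hw) (hb w hw)
  simpa using key 1 one

theorem Fch.linearMap_ext {f g : Module.End ℂ (Fch p)} (one : f 1 = g 1)
    (mul : ∀ x v, f v = g v → f (gen p x * v) = g (gen p x * v)) : f = g :=
  LinearMap.ext fun v => Fch.induction (LinearMap.eqLocus f g) one (fun x v hv => mul x v hv) v

/-! ### Superderivations -/

variable (p) in
/-- The automorphism `v ↦ (-1) ^ (ε v) v`. -/
def sigma (ε : ZMod 2) : Fch p →ₐ[ℂ] Fch p :=
  Fch.lift (fun x => sgn (ε * par p x) • gen p x) fun x y => by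
    simp only [smul_mul_smul_comm]
    rw [gen_mul_gen, smul_smul, smul_smul]
    congr 1; ring

theorem sigma_gen (ε : ZMod 2) (x : Gen A) :
    sigma p ε (gen p x) = sgn (ε * par p x) • gen p x := Fch.lift_gen ..

/-- Upper triangular matrices whose corner is the superderivation below. -/
def superDerAux (ε : ZMod 2) (c : Gen A → Fch p)
    (hc : ∀ x y, c x * gen p y = sgn ((par p x + ε) * par p y) • (gen p y * c x)) :
    Fch p →ₐ[ℂ] Matrix (Fin 2) (Fin 2) (Fch p) :=
  Fch.lift (fun x => !![sigma p ε (gen p x), c x; 0, gen p x]) fun x y => by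
    have h1 := map_mul (sigma p ε) (gen p x) (gen p y)
    rw [gen_mul_gen, map_smul, map_mul] at h1
    have h2 : sigma p ε (gen p x) * c y + c x * gen p y =
        sgn (par p x * par p y) • (sigma p ε (gen p y) * c x + c y * gen p x) := by
      rw [hc x y, hc y x, sigma_gen, sigma_gen, smul_mul_assoc, smul_mul_assoc, smul_add,
        smul_smul, smul_smul, add_comm, ← sgn_add, ← sgn_add]
      have e1 : ∀ ε u v : ZMod 2, (u + ε) * v = u * v + ε * v := by decide
      have e2 : ∀ ε u v : ZMod 2, ε * u = u * v + (v + ε) * u := by decide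
      rw [e1, ← e2]
    ext i j
    fin_cases i <;> fin_cases j
    · simpa [Matrix.mul_apply, Fin.sum_univ_two] using h1.symm
    · simpa [Matrix.mul_apply, Fin.sum_univ_two] using h2
    · simp [Matrix.mul_apply, Fin.sum_univ_two]
    · simpa [Matrix.mul_apply, Fin.sum_univ_two] using gen_mul_gen x y

/-- The superderivation `δ` of parity `ε`, `δ (u v) = δ(u) v + (-1) ^ (ε u) u δ(v)`, with the values
`δ x = c x` on generators. -/
def superDer (ε : ZMod 2) (c : Gen A → Fch p)
    (hc : ∀ x y, c x * gen p y = sgn ((par p x + ε) * par p y) • (gen p y * c x)) :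
    Module.End ℂ (Fch p) where
  toFun v := superDerAux ε c hc v 0 1
  map_add' u v := by simp
  map_smul' r v := by simp

theorem superDer_one (ε : ZMod 2) (c : Gen A → Fch p)
    (hc : ∀ x y, c x * gen p y = sgn ((par p x + ε) * par p y) • (gen p y * c x)) :
    superDer ε c hc 1 = 0 := by
  change superDerAux ε c hc 1 0 1 = 0
  simp

theorem superDer_gen (ε : ZMod 2) (c : Gen A → Fch p)
    (hc : ∀ x y, c x * gen p y = sgn ((par p x + ε) * par p y) • (gen p y * c x))
    (x : Gen A) : superDer ε c hc (gen p x) = c x := by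
  change superDerAux ε c hc _ 0 1 = _
  rw [superDerAux, Fch.lift_gen]; rfl

theorem superDer_gen_mul (ε : ZMod 2) (c : Gen A → Fch p)
    (hc : ∀ x y, c x * gen p y = sgn ((par p x + ε) * par p y) • (gen p y * c x))
    (x : Gen A) (v : Fch p) : superDer ε c hc (gen p x * v) =
      c x * v + sgn (ε * par p x) • (gen p x * superDer ε c hc v) := by
  have h11 : superDerAux ε c hc v 1 1 = v := by
    let S : Submodule ℂ (Fch p) :=
      { carrier := {v | superDerAux ε c hc v 1 1 = v}
        add_mem' := fun {a b} ha hb => by simp_all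
        zero_mem' := by simp
        smul_mem' := fun r a ha => by simp_all }
    refine Fch.induction S (by simp [S]) (fun y w (hw : _ = w) => ?_) v
    change superDerAux ε c hc (gen p y * w) 1 1 = _
    have hg : superDerAux ε c hc (gen p y) = !![sigma p ε (gen p y), c y; 0, gen p y] :=
      Fch.lift_gen ..
    rw [map_mul, hg]
    simp [Matrix.mul_apply, Fin.sum_univ_two, hw]
  change superDerAux ε c hc (gen p x * v) 0 1 = _ + _ • (_ * superDerAux ε c hc v 0 1)
  have hg : superDerAux ε c hc (gen p x) = !![sigma p ε (gen p x), c x; 0, gen p x] :=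
    Fch.lift_gen ..
  rw [map_mul, ← smul_mul_assoc, ← sigma_gen, hg]
  simp [Matrix.mul_apply, Fin.sum_univ_two, h11, add_comm]

variable (p) in
/-- The odd derivation `D`. -/
def D : Module.End ℂ (Fch p) :=
  superDer 1 (fun x => gen p (x.shift 1)) fun x y => by
    rw [gen_mul_gen, par_shift]; simp

variable (p) in
/-- The even derivation `∂ = D ^ 2`. -/
def del : Module.End ℂ (Fch p) := D p * D p

/-! ### The superfields of the generators -/

section

variable [DecidableEq A]

variable (p) in
/-- The annihilation operator `x_(n|k)`, `n ≥ 0`: by the Wick formula (whose integral term vanishes,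
since `[x Λ y]` is a multiple of the vacuum for `x, y ∈ R`) it is the superderivation with the values
`x_(n|k) y` on `R`; its parity is `x + k + 1`. -/
def annihilation (x : Gen A) (n : ℕ) (k : ZMod 2) : Module.End ℂ (Fch p) :=
  superDer (par p x + k + 1) (fun y => algebraMap ℂ (Fch p) (contraction p x y n k)) fun y z => by
    by_cases h : contraction p x y n k = 0
    · simp [h]
    · rw [par_of_contraction_ne_zero p x y n k h, CharTwo.add_self_eq_zero, zero_mul, sgn_zero,
        one_smul]
      exact Algebra.commutes _ _

variable (p) in
/-- The coefficients `x_(n|k)` of the superfield of a basis vector `x` of `R`.  For `n = -m-1 < 0`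
they are the multiplications by `∂ ^ m x / m!` if `k = 1`, and by `∂ ^ m D x / m!` if `k = 0`. -/
def genMode (x : Gen A) (k : ZMod 2) : ℤ → Module.End ℂ (Fch p)
  | Int.ofNat n => annihilation p x n k
  | Int.negSucc m => ((m.factorial : ℂ)⁻¹) •
      LinearMap.mulLeft ℂ (gen p (x.shift (2 * m + if k = 0 then 1 else 0)))

theorem annihilation_eq_zero_of_large (x : Gen A) (k : ZMod 2) (v : Fch p) :
    ∃ N, ∀ n ≥ N, annihilation p x n k v = 0 := by
  let S : Submodule ℂ (Fch p) :=
    { carrier := {v | ∃ N, ∀ n ≥ N, annihilation p x n k v = 0}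
      add_mem' := by
        rintro a b ⟨N, hN⟩ ⟨M, hM⟩
        exact ⟨max N M, fun n hn => by
          rw [map_add, hN n (le_trans (le_max_left _ _) hn), hM n (le_trans (le_max_right _ _) hn),
            add_zero]⟩
      zero_mem' := ⟨0, fun n _ => by simp⟩
      smul_mem' := by
        rintro r a ⟨N, hN⟩
        exact ⟨N, fun n hn => by rw [map_smul, hN n hn, smul_zero]⟩ }
  refine Fch.induction S ⟨0, fun n _ => superDer_one _ _ _⟩ ?_ v
  rintro y w ⟨N, hN⟩
  obtain ⟨M, hM⟩ := contraction_eq_zero_of_large p x y k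
  refine ⟨max N M, fun n hn => ?_⟩
  have h1 := hN n (le_trans (le_max_left _ _) hn)
  unfold annihilation at h1 ⊢
  rw [superDer_gen_mul, h1, hM n (le_trans (le_max_right _ _) hn)]
  simp

end

/-! ### Fields and normally ordered products -/

section

variable {V : Type*} [AddCommGroup V] [Module ℂ V]

theorem modes_bddBelow (f : ℤ → Module.End ℂ V) (hf : ∀ v, ∃ N : ℤ, ∀ n ≥ N, f n v = 0)
    (v : V) : BddBelow (Function.support fun m : ℤ => f (-m - 1) v) := by
  obtain ⟨N, hN⟩ := hf v
  refine ⟨-N, fun m hm => ?_⟩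
  by_contra h
  exact hm (hN _ (by omega))

/-- The field `∑ z ^ (-n-1) f n` with given coefficients. -/
def ofModes (f : ℤ → Module.End ℂ V) (hf : ∀ v, ∃ N : ℤ, ∀ n ≥ N, f n v = 0) :
    VertexOperator ℂ V :=
  VertexOperator.of_coeff (fun m => f (-m - 1)) (modes_bddBelow f hf)

theorem ncoeff_ofModes (f : ℤ → Module.End ℂ V) (hf : ∀ v, ∃ N : ℤ, ∀ n ≥ N, f n v = 0)
    (n : ℤ) : ncoeff (ofModes f hf) n = f n := by
  rw [ofModes, VertexOperator.ncoeff_of_coeff]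
  congr 1; ring

theorem ncoeff_eventually_zero (B : VertexOperator ℂ V) (v : V) :
    ∃ N : ℤ, ∀ n ≥ N, ncoeff B n v = 0 :=
  ⟨-(HahnSeries.order ((HahnModule.of ℂ).symm (B v))), fun n hn =>
    VertexOperator.ncoeff_eq_zero_of_lt_order B n v (by omega)⟩

theorem field_ext {B C : VertexOperator ℂ V}
    (h : ∀ n v, ncoeff B n v = ncoeff C n v) : B = C := by
  apply HVertexOperator.coeff_inj
  funext m
  rw [VertexOperator.coeff_eq_ncoeff, VertexOperator.coeff_eq_ncoeff]
  exact LinearMap.ext fun v => h _ v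

/-- The sum of a sequence of operators which is finite on every vector. -/
def locSum (f : ℕ → Module.End ℂ V) (hf : ∀ v, (Function.support fun j => f j v).Finite) :
    Module.End ℂ V where
  toFun v := ∑ᶠ j, f j v
  map_add' u v := by
    simp only [map_add]
    exact finsum_add_distrib (hf u) (hf v)
  map_smul' r v := by
    simp only [map_smul, RingHom.id_apply]
    exact (smul_finsum r _).symm

theorem locSum_apply (f : ℕ → Module.End ℂ V)
    (hf : ∀ v, (Function.support fun j => f j v).Finite) (v : V) :
    locSum f hf v = ∑ᶠ j, f j v := rfl

theorem support_finite_of_large {W : Type*} [Zero W] (f : ℕ → W)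
    (N : ℤ) (h : ∀ j : ℕ, (j : ℤ) ≥ N → f j = 0) : (Function.support f).Finite := by
  refine (Set.finite_Iio N.toNat).subset fun j hj => ?_
  by_contra hlt
  exact hj (h j (by simp at hlt; omega))

theorem creation_finite (a B : VertexOperator ℂ V) (n : ℤ) (v : V) :
    (Function.support fun j : ℕ => (ncoeff a (-(j : ℤ) - 1) * ncoeff B (n + j)) v).Finite := by
  obtain ⟨N, hN⟩ := ncoeff_eventually_zero B v
  refine support_finite_of_large _ (N - n) fun j hj => ?_
  rw [Module.End.mul_apply, hN _ (by omega), map_zero]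

theorem annihilation_finite (s : Module.End ℂ V) (a B : VertexOperator ℂ V) (n : ℤ) (v : V) :
    (Function.support fun j : ℕ =>
      (s * ncoeff B (n - j - 1) * s * ncoeff a j) v).Finite := by
  obtain ⟨N, hN⟩ := ncoeff_eventually_zero a v
  refine support_finite_of_large _ N fun j hj => ?_
  rw [Module.End.mul_apply, hN _ hj, map_zero]

theorem creation_large (a B : VertexOperator ℂ V) (v : V) :
    ∃ N : ℤ, ∀ n ≥ N, locSum _ (creation_finite a B n) v = 0 := by
  obtain ⟨N, hN⟩ := ncoeff_eventually_zero B v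
  refine ⟨N, fun n hn => (locSum_apply _ _ _).trans
    (finsum_eq_zero_of_forall_eq_zero fun j => ?_)⟩
  rw [Module.End.mul_apply, hN _ (by omega), map_zero]

theorem annihilation_large (s : Module.End ℂ V) (a B : VertexOperator ℂ V) (v : V) :
    ∃ N : ℤ, ∀ n ≥ N, locSum _ (annihilation_finite s a B n) v = 0 := by
  choose N hN using fun w => ncoeff_eventually_zero B w
  obtain ⟨M, hM⟩ := ncoeff_eventually_zero a v
  let w : ℕ → V := fun j => s (ncoeff a j v)
  obtain ⟨L, hL⟩ := ((Finset.range M.toNat).image fun j => N (w j) + j + 1).bddAbove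
  refine ⟨L, fun n hn => (locSum_apply _ _ _).trans
    (finsum_eq_zero_of_forall_eq_zero fun j => ?_)⟩
  by_cases hj : (j : ℤ) ≥ M
  · rw [Module.End.mul_apply, hM _ hj, map_zero]
  · have : N (w j) + j + 1 ≤ L := hL (by
      simp only [Finset.coe_image, Finset.coe_range, Set.mem_image, Set.mem_Iio]
      exact ⟨j, by omega, rfl⟩)
    rw [Module.End.mul_apply, Module.End.mul_apply, Module.End.mul_apply,
      hN (w j) _ (by omega), map_zero]

/-- `a(z)_+ B(z)`, where `a(z)_+ = ∑_{j < 0} z ^ (-j-1) a_(j)`. -/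
def creationPart (a B : VertexOperator ℂ V) : VertexOperator ℂ V :=
  ofModes (fun n => locSum _ (creation_finite a B n)) (creation_large a B)

/-- `s B(z) s a(z)_-`, where `a(z)_- = ∑_{j ≥ 0} z ^ (-j-1) a_(j)`. -/
def annihilationPart (s : Module.End ℂ V) (a B : VertexOperator ℂ V) : VertexOperator ℂ V :=
  ofModes (fun n => locSum _ (annihilation_finite s a B n)) (annihilation_large s a B)

theorem ncoeff_creationPart (a B : VertexOperator ℂ V) (n : ℤ) (v : V) :
    ncoeff (creationPart a B) n v =
      ∑ᶠ j : ℕ, (ncoeff a (-(j : ℤ) - 1) * ncoeff B (n + j)) v := by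
  rw [creationPart, ncoeff_ofModes, locSum_apply]

theorem ncoeff_annihilationPart (s : Module.End ℂ V) (a B : VertexOperator ℂ V) (n : ℤ) (v : V) :
    ncoeff (annihilationPart s a B) n v =
      ∑ᶠ j : ℕ, (s * ncoeff B (n - j - 1) * s * ncoeff a j) v := by
  rw [annihilationPart, ncoeff_ofModes, locSum_apply]

/-- The normally ordered product of fields `a(z)_+ B(z) + s B(z) s a(z)_-`, linear in `B`.  Here `s`
is the operator `v ↦ (-1) ^ (a v) v`, so that `s B s = (-1) ^ (a B) B` for `B` of definite
parity. -/
def normalOrder (s : Module.End ℂ V) (a : VertexOperator ℂ V) :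
    VertexOperator ℂ V →ₗ[ℂ] VertexOperator ℂ V where
  toFun B := creationPart a B + annihilationPart s a B
  map_add' B C := field_ext fun n v => by
    have h1 : ncoeff (creationPart a (B + C)) n v =
        ncoeff (creationPart a B) n v + ncoeff (creationPart a C) n v := by
      simp only [ncoeff_creationPart]
      rw [← finsum_add_distrib (creation_finite a B n v) (creation_finite a C n v)]
      exact finsum_congr fun j => by simp
    have h2 : ncoeff (annihilationPart s a (B + C)) n v =
        ncoeff (annihilationPart s a B) n v + ncoeff (annihilationPart s a C) n v := by
      simp only [ncoeff_annihilationPart]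
      rw [← finsum_add_distrib (annihilation_finite s a B n v) (annihilation_finite s a C n v)]
      exact finsum_congr fun j => by simp
    simp only [map_add, Pi.add_apply, LinearMap.add_apply, h1, h2]
    abel
  map_smul' r B := field_ext fun n v => by
    have h1 : ncoeff (creationPart a (r • B)) n v = r • ncoeff (creationPart a B) n v := by
      simp only [ncoeff_creationPart]
      rw [smul_finsum]
      exact finsum_congr fun j => by simp
    have h2 : ncoeff (annihilationPart s a (r • B)) n v =
        r • ncoeff (annihilationPart s a B) n v := by
      simp only [ncoeff_annihilationPart]
      rw [smul_finsum]
      exact finsum_congr fun j => by simp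
    simp only [map_add, map_smul, Pi.add_apply, Pi.smul_apply, LinearMap.add_apply,
      LinearMap.smul_apply, RingHom.id_apply, h1, h2, smul_add]

variable (V) in
/-- The identity field. -/
def identityField : VertexOperator ℂ V :=
  ofModes (fun n => if n = -1 then 1 else 0) fun v =>
    ⟨0, fun n hn => by rw [if_neg (by omega)]; rfl⟩

theorem finsum_swap {V : Type*} [AddCommGroup V] (g : ℕ → ℕ → V) (N : ℕ) (M : ℕ → ℕ) (hN : ∀ i ≥ N, ∀ k, g i k = 0)
    (hM : ∀ i, ∀ k ≥ M i, g i k = 0) : ∑ᶠ i, ∑ᶠ k, g i k = ∑ᶠ k, ∑ᶠ i, g i k := by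
  have hfin : (Function.support (Function.uncurry g)).Finite := by
    refine ((Set.finite_Iio N).biUnion (t := fun i => {i} ×ˢ Set.Iio (M i))
      fun i _ => (Set.finite_singleton i).prod (Set.finite_Iio _)).subset ?_
    rintro ⟨i, k⟩ h
    simp only [Set.mem_iUnion, Set.mem_Iio, Set.mem_prod, Set.mem_singleton_iff]
    refine ⟨i, ?_, rfl, ?_⟩
    · by_contra hi
      exact h (hN i (by omega) k)
    · by_contra hk
      exact h (hM i k (by omega))
  have hfin' : (Function.support fun q : ℕ × ℕ => g q.2 q.1).Finite :=
    (hfin.image Prod.swap).subset fun q hq => ⟨q.swap, hq, rfl⟩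
  have h1 := finsum_curry _ hfin
  have h2 := finsum_curry _ hfin'
  simp only [Function.uncurry] at h1 h2
  rw [← h1, ← h2]
  exact finsum_eq_of_bijective Prod.swap Prod.swap_bijective fun q => rfl

theorem creation_creation (a c B : VertexOperator ℂ V) (n : ℤ) (v : V) :
    ncoeff (creationPart a (creationPart c B)) n v = ∑ᶠ i : ℕ, ∑ᶠ k : ℕ,
      (ncoeff a (-(i : ℤ) - 1) * ncoeff c (-(k : ℤ) - 1) * ncoeff B (n + i + k)) v := by
  rw [ncoeff_creationPart]
  refine finsum_congr fun i => ?_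
  rw [Module.End.mul_apply, ncoeff_creationPart, map_finsum _ (creation_finite c B _ v)]
  rfl

theorem creation_annihilation (u : Module.End ℂ V) (a c B : VertexOperator ℂ V) (n : ℤ) (v : V) :
    ncoeff (creationPart a (annihilationPart u c B)) n v = ∑ᶠ i : ℕ, ∑ᶠ k : ℕ,
      (ncoeff a (-(i : ℤ) - 1) * (u * ncoeff B (n + i - k - 1) * u * ncoeff c k)) v := by
  rw [ncoeff_creationPart]
  refine finsum_congr fun i => ?_
  rw [Module.End.mul_apply, ncoeff_annihilationPart, map_finsum _ (annihilation_finite u c B _ v)]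
  rfl

theorem annihilation_creation (u : Module.End ℂ V) (a c B : VertexOperator ℂ V) (n : ℤ) (v : V) :
    ncoeff (annihilationPart u c (creationPart a B)) n v = ∑ᶠ k : ℕ, ∑ᶠ i : ℕ,
      (u * (ncoeff a (-(i : ℤ) - 1) * ncoeff B (n - k - 1 + i)) * u * ncoeff c k) v := by
  rw [ncoeff_annihilationPart]
  refine finsum_congr fun i => ?_
  simp only [Module.End.mul_apply]
  rw [ncoeff_creationPart, map_finsum _ (creation_finite a B _ _)]
  rfl

theorem annihilation_annihilation (s u : Module.End ℂ V) (a c B : VertexOperator ℂ V) (n : ℤ)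
    (v : V) : ncoeff (annihilationPart s a (annihilationPart u c B)) n v = ∑ᶠ i : ℕ, ∑ᶠ k : ℕ,
      (s * (u * ncoeff B (n - i - 1 - k - 1) * u * ncoeff c k) * s * ncoeff a i) v := by
  rw [ncoeff_annihilationPart]
  refine finsum_congr fun i => ?_
  simp only [Module.End.mul_apply]
  rw [ncoeff_annihilationPart, map_finsum _ (annihilation_finite u c B _ _)]
  rfl

theorem creation_creation_comm (a c B : VertexOperator ℂ V) (ε : ℂ)
    (hneg : ∀ i k : ℕ, ncoeff a (-(i : ℤ) - 1) * ncoeff c (-(k : ℤ) - 1) =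
      ε • (ncoeff c (-(k : ℤ) - 1) * ncoeff a (-(i : ℤ) - 1))) (n : ℤ) (v : V) :
    ncoeff (creationPart a (creationPart c B)) n v =
      ε • ncoeff (creationPart c (creationPart a B)) n v := by
  obtain ⟨N, hN⟩ := ncoeff_eventually_zero B v
  rw [creation_creation, creation_creation, finsum_swap _ (N - n).toNat (fun _ => (N - n).toNat),
    smul_finsum]
  · refine finsum_congr fun k => ?_
    rw [smul_finsum]
    refine finsum_congr fun i => ?_
    rw [hneg, add_right_comm, smul_mul_assoc, LinearMap.smul_apply]
  · intro i hi k
    rw [Module.End.mul_apply, hN _ (by omega), map_zero]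
  · intro i k hk
    rw [Module.End.mul_apply, hN _ (by omega), map_zero]

theorem creation_annihilation_comm (u : Module.End ℂ V) (a c B : VertexOperator ℂ V) (ε : ℂ)
    (hε : ε * ε = 1) (hu : ∀ n, u * ncoeff a n = ε • (ncoeff a n * u)) (n : ℤ) (v : V) :
    ncoeff (creationPart a (annihilationPart u c B)) n v =
      ε • ncoeff (annihilationPart u c (creationPart a B)) n v := by
  obtain ⟨K, hK⟩ := ncoeff_eventually_zero c v
  choose N hN using fun w => ncoeff_eventually_zero B w
  rw [creation_annihilation, annihilation_creation]
  refine Eq.trans (finsum_swap (fun k i => (ncoeff a (-(i : ℤ) - 1) *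
    (u * ncoeff B (n + i - k - 1) * u * ncoeff c k)) v) K.toNat
    (fun k => (N (u (ncoeff c k v)) - n + k + 1).toNat) ?_ ?_).symm ?_
  rotate_left 2
  · rw [smul_finsum]
    refine finsum_congr fun i => ?_
    rw [smul_finsum]
    refine finsum_congr fun k => ?_
    rw [← mul_assoc u, hu, smul_mul_assoc, smul_mul_assoc, smul_mul_assoc, LinearMap.smul_apply,
      smul_smul, hε, one_smul]
    have e : n + (k : ℤ) - i - 1 = n - i - 1 + k := by ring
    rw [e]
    simp only [mul_assoc]
  · intro k hk i
    simp only [Module.End.mul_apply]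
    rw [hK _ (by omega)]
    simp
  · intro k i hi
    simp only [Module.End.mul_apply]
    rw [hN _ _ (by omega)]
    simp

theorem annihilation_annihilation_comm (s u : Module.End ℂ V) (a c B : VertexOperator ℂ V) (ε : ℂ)
    (hε : ε * ε = 1) (hsu : s * u = u * s)
    (hs : ∀ n, s * ncoeff c n = ε • (ncoeff c n * s))
    (hu : ∀ n, u * ncoeff a n = ε • (ncoeff a n * u))
    (hpos : ∀ i k : ℕ, ncoeff a i * ncoeff c k = ε • (ncoeff c k * ncoeff a i))
    (n : ℤ) (v : V) :
    ncoeff (annihilationPart s a (annihilationPart u c B)) n v =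
      ε • ncoeff (annihilationPart u c (annihilationPart s a B)) n v := by
  obtain ⟨I, hI⟩ := ncoeff_eventually_zero a v
  choose K hK using fun w => ncoeff_eventually_zero c w
  rw [annihilation_annihilation, annihilation_annihilation, smul_finsum, finsum_swap _ I.toNat
    (fun i => (K (s (ncoeff a i v))).toNat)]
  · refine finsum_congr fun k => ?_
    rw [smul_finsum]
    refine finsum_congr fun i => ?_
    have e : n - i - 1 - k - 1 = n - k - 1 - i - 1 := by ring
    have h1 : s * (u * ncoeff B (n - i - 1 - k - 1) * u * ncoeff c k) * s * ncoeff a i =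
        s * u * ncoeff B (n - k - 1 - i - 1) * (u * (ncoeff c k * s) * ncoeff a i) := by
      rw [e]; simp only [mul_assoc]
    have h2 : u * (s * ncoeff B (n - k - 1 - i - 1) * s * ncoeff a i) * u * ncoeff c k =
        s * u * ncoeff B (n - k - 1 - i - 1) * (s * (ncoeff a i * u) * ncoeff c k) := by
      rw [hsu]; simp only [mul_assoc]
    have h3 : u * (ncoeff c k * s) * ncoeff a i =
        ε • (s * (ncoeff a i * u) * ncoeff c k) := by
      have h4 : ncoeff c k * s = ε • (s * ncoeff c k) := by rw [hs, smul_smul, hε, one_smul]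
      have h5 : ncoeff c k * ncoeff a i = ε • (ncoeff a i * ncoeff c k) := by
        rw [hpos, smul_smul, hε, one_smul]
      calc u * (ncoeff c k * s) * ncoeff a i
          = ε • (u * s * (ncoeff c k * ncoeff a i)) := by
            rw [h4]; simp only [mul_smul_comm, smul_mul_assoc, mul_assoc]
        _ = s * (u * ncoeff a i) * ncoeff c k := by
            rw [h5, ← hsu, mul_smul_comm, smul_smul, hε, one_smul]; simp only [mul_assoc]
        _ = ε • (s * (ncoeff a i * u) * ncoeff c k) := by
            rw [hu]; simp only [mul_smul_comm, smul_mul_assoc, mul_assoc]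
    rw [h1, h2, h3, mul_smul_comm, LinearMap.smul_apply]
  · intro i hi k
    simp only [Module.End.mul_apply]
    rw [hI _ (by omega)]
    simp
  · intro i k hk
    simp only [Module.End.mul_apply]
    rw [hK _ _ (by omega)]
    simp

/-- Supercommutation of the creation and of the annihilation parts implies supercommutation of
normally ordered multiplications. -/
theorem normalOrder_comm (s u : Module.End ℂ V) (a c B : VertexOperator ℂ V) (ε : ℂ)
    (hε : ε * ε = 1) (hsu : s * u = u * s)
    (hs : ∀ n, s * ncoeff c n = ε • (ncoeff c n * s))
    (hu : ∀ n, u * ncoeff a n = ε • (ncoeff a n * u))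
    (hneg : ∀ i k : ℕ, ncoeff a (-(i : ℤ) - 1) * ncoeff c (-(k : ℤ) - 1) =
      ε • (ncoeff c (-(k : ℤ) - 1) * ncoeff a (-(i : ℤ) - 1)))
    (hpos : ∀ i k : ℕ, ncoeff a i * ncoeff c k = ε • (ncoeff c k * ncoeff a i)) :
    normalOrder s a (normalOrder u c B) = ε • normalOrder u c (normalOrder s a B) := by
  refine field_ext fun n v => ?_
  have h1 : normalOrder u c B = creationPart c B + annihilationPart u c B := rfl
  have h2 : normalOrder s a B = creationPart a B + annihilationPart s a B := rfl
  have h3 : ∀ X, normalOrder s a X = creationPart a X + annihilationPart s a X := fun _ => rfl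
  have h4 : ∀ X, normalOrder u c X = creationPart c X + annihilationPart u c X := fun _ => rfl
  rw [h1, h2, map_add (normalOrder s a), map_add (normalOrder u c), h3, h3, h4, h4]
  have hc := creation_annihilation_comm s c a B ε hε hs n v
  have hc' : ncoeff (annihilationPart s a (creationPart c B)) n v =
      ε • ncoeff (creationPart c (annihilationPart s a B)) n v := by
    rw [hc, smul_smul, hε, one_smul]
  simp only [map_add, map_smul, Pi.add_apply, Pi.smul_apply, LinearMap.add_apply,
    LinearMap.smul_apply, smul_add]
  rw [creation_creation_comm a c B ε hneg, creation_annihilation_comm u a c B ε hε hu, hc',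
    annihilation_annihilation_comm s u a c B ε hε hsu hs hu hpos]
  abel

end

/-! ### Sign rules for the modes of the generators -/

variable (p) in
/-- The automorphism `sigma` as an operator. -/
def sigmaEnd (ε : ZMod 2) : Module.End ℂ (Fch p) := (sigma p ε).toLinearMap

theorem sigmaEnd_gen_mul (ε : ZMod 2) (x : Gen A) (v : Fch p) :
    sigmaEnd p ε (gen p x * v) = sgn (ε * par p x) • (gen p x * sigmaEnd p ε v) := by
  change sigma p ε (gen p x * v) = _ • (_ * sigma p ε v)
  rw [map_mul, sigma_gen, smul_mul_assoc]

theorem sigmaEnd_one (ε : ZMod 2) : sigmaEnd p ε 1 = 1 := map_one (sigma p ε)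

theorem sigmaEnd_comm (ε δ : ZMod 2) :
    sigmaEnd p ε * sigmaEnd p δ = sigmaEnd p δ * sigmaEnd p ε := by
  refine Fch.linearMap_ext (by simp [sigmaEnd_one]) fun x v h => ?_
  simp only [Module.End.mul_apply] at h ⊢
  rw [sigmaEnd_gen_mul, map_smul, sigmaEnd_gen_mul, sigmaEnd_gen_mul, map_smul, sigmaEnd_gen_mul,
    h, smul_comm]

variable (p) in
/-- The parity `x + k + 1` of `x_(n|k)`. -/
def modePar (x : Gen A) (k : ZMod 2) : ZMod 2 := par p x + k + 1

variable (p) in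
/-- The generator which is created by `x_(-m-1|k)`. -/
def created (x : Gen A) (k : ZMod 2) (m : ℕ) : Gen A :=
  x.shift (2 * m + if k = 0 then 1 else 0)

theorem par_created (x : Gen A) (k : ZMod 2) (m : ℕ) :
    par p (created x k m) = modePar p x k := by
  have h2 : (2 : ZMod 2) = 0 := rfl
  have h : ∀ k : ZMod 2, k = 0 ∨ k = 1 := by decide
  rw [created, par_shift, modePar]
  rcases h k with rfl | rfl
  · simp [h2]
  · simp [h2, add_assoc, CharTwo.add_self_eq_zero]

section

variable [DecidableEq A]

theorem annihilation_one (x : Gen A) (n : ℕ) (k : ZMod 2) : annihilation p x n k 1 = 0 :=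
  superDer_one ..

theorem annihilation_gen_mul (x y : Gen A) (n : ℕ) (k : ZMod 2) (v : Fch p) :
    annihilation p x n k (gen p y * v) = contraction p x y n k • v +
      sgn (modePar p x k * par p y) • (gen p y * annihilation p x n k v) := by
  unfold annihilation
  rw [superDer_gen_mul, ← Algebra.smul_def]
  rfl

theorem sgn_of_contraction_smul (x y : Gen A) (n : ℕ) (k δ : ZMod 2) (v : Fch p) :
    sgn (δ * par p y) • contraction p x y n k • v =
      sgn (δ * modePar p x k) • contraction p x y n k • v := by
  by_cases h : contraction p x y n k = 0
  · simp [h]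
  · rw [par_of_contraction_ne_zero p x y n k h, modePar]

theorem sigmaEnd_annihilation (ε : ZMod 2) (x : Gen A) (n : ℕ) (k : ZMod 2) :
    sigmaEnd p ε * annihilation p x n k =
      sgn (ε * modePar p x k) • (annihilation p x n k * sigmaEnd p ε) := by
  refine Fch.linearMap_ext (by simp [sigmaEnd_one, annihilation_one]) fun y v h => ?_
  simp only [Module.End.mul_apply, LinearMap.smul_apply] at h ⊢
  rw [annihilation_gen_mul, sigmaEnd_gen_mul, map_add, map_smul, map_smul, map_smul,
    annihilation_gen_mul, sigmaEnd_gen_mul, h, smul_add, smul_add,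
    sgn_of_contraction_smul x y n k ε, smul_smul (sgn (ε * modePar p x k)) (sgn _), ← sgn_add,
    CharTwo.add_self_eq_zero, sgn_zero, one_smul, mul_smul_comm]
  congr 1
  simp only [smul_smul]
  congr 1; ring

theorem annihilation_comm (x y : Gen A) (n m : ℕ) (k l : ZMod 2) :
    annihilation p x n k * annihilation p y m l = sgn (modePar p x k * modePar p y l) •
      (annihilation p y m l * annihilation p x n k) := by
  refine Fch.linearMap_ext (by simp [annihilation_one]) fun z v h => ?_
  simp only [Module.End.mul_apply, LinearMap.smul_apply] at h ⊢
  have e1 := sgn_of_contraction_smul (p := p) x z n k (modePar p y l) (annihilation p y m l v)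
  have e2 := sgn_of_contraction_smul (p := p) y z m l (modePar p x k) (annihilation p x n k v)
  simp only [annihilation_gen_mul, map_add, map_smul, smul_add, h, mul_smul_comm]
  rw [e1, e2, mul_comm (modePar p y l) (modePar p x k),
    smul_smul (sgn (modePar p x k * modePar p y l)) (sgn (modePar p x k * modePar p y l)),
    sgn_mul_self, one_smul]
  module

theorem genMode_natCast (x : Gen A) (k : ZMod 2) (n : ℕ) :
    genMode p x k n = annihilation p x n k := rfl

theorem genMode_neg (x : Gen A) (k : ZMod 2) (m : ℕ) :
    genMode p x k (-(m : ℤ) - 1) = ((m.factorial : ℂ)⁻¹) •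
      LinearMap.mulLeft ℂ (gen p (created x k m)) := by
  have : -(m : ℤ) - 1 = Int.negSucc m := by omega
  rw [this]; rfl

theorem sigmaEnd_genMode (ε : ZMod 2) (x : Gen A) (k : ZMod 2) (n : ℤ) :
    sigmaEnd p ε * genMode p x k n =
      sgn (ε * modePar p x k) • (genMode p x k n * sigmaEnd p ε) := by
  rcases n with n | m
  · exact sigmaEnd_annihilation ε x n k
  · have e : Int.negSucc m = -(m : ℤ) - 1 := by omega
    rw [e, genMode_neg]
    ext v
    simp only [Module.End.mul_apply, LinearMap.smul_apply, map_smul, LinearMap.mulLeft_apply,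
      sigmaEnd_gen_mul, par_created]
    rw [smul_comm]

theorem genMode_neg_comm (x y : Gen A) (k l : ZMod 2) (i j : ℕ) :
    genMode p x k (-(i : ℤ) - 1) * genMode p y l (-(j : ℤ) - 1) =
      sgn (modePar p x k * modePar p y l) •
        (genMode p y l (-(j : ℤ) - 1) * genMode p x k (-(i : ℤ) - 1)) := by
  rw [genMode_neg, genMode_neg]
  ext v
  simp only [Module.End.mul_apply, LinearMap.smul_apply, map_smul, LinearMap.mulLeft_apply]
  rw [← mul_assoc, gen_mul_gen, par_created, par_created, smul_mul_assoc, mul_assoc]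
  simp only [smul_smul]
  congr 1; ring

/-! ### Superfields and the state-field correspondence -/

variable (p) in
/-- An `N = 1` superfield `∑ z ^ (-j-1) a_(j|1) + θ ∑ z ^ (-j-1) a_(j|0)`: the value at `k` is
`∑ z ^ (-j-1) a_(j|k)`. -/
abbrev SuperField := ZMod 2 → VertexOperator ℂ (Fch p)

variable (p) in
/-- The superfield of a basis vector of `R`. -/
def genField (x : Gen A) : SuperField p := fun k => ofModes (genMode p x k) fun v => by
  obtain ⟨N, hN⟩ := annihilation_eq_zero_of_large (p := p) x k v
  refine ⟨N, fun n hn => ?_⟩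
  obtain ⟨m, rfl⟩ : ∃ m : ℕ, n = m := ⟨n.toNat, by omega⟩
  exact hN m (by omega)

/-- The normally ordered product `:a B: = a_+ B + (-1) ^ (a B) B a_-` of superfields, where `a` has
parity `ε`.  As `a = a¹ + θ a⁰`, `B = B¹ + θ B⁰` and `a¹ θ = (-1) ^ ε θ a¹`, this is
`:a¹ B¹: + θ (:a⁰ B¹: + (-1) ^ ε :a¹ B⁰:)`, with `a¹`, `a⁰` of parities `ε`, `ε + 1`. -/
def superNormalOrder (ε : ZMod 2) (a : SuperField p) : Module.End ℂ (SuperField p) where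
  toFun B := fun k =>
    if k = 1 then normalOrder (sigmaEnd p ε) (a 1) (B 1)
    else normalOrder (sigmaEnd p (ε + 1)) (a 0) (B 1) +
      sgn ε • normalOrder (sigmaEnd p ε) (a 1) (B 0)
  map_add' B C := by
    funext k
    simp only [Pi.add_apply, map_add, smul_add]
    split_ifs
    · rfl
    · abel
  map_smul' r B := by
    funext k
    simp only [Pi.smul_apply, map_smul, RingHom.id_apply]
    split_ifs
    · rfl
    · rw [smul_add, smul_comm r]

theorem normalOrder_genField_comm (x y : Gen A) (k l ε δ : ZMod 2) (hε : ε = modePar p x k)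
    (hδ : δ = modePar p y l) (B : VertexOperator ℂ (Fch p)) :
    normalOrder (sigmaEnd p ε) (genField p x k) (normalOrder (sigmaEnd p δ) (genField p y l) B) =
      sgn (ε * δ) • normalOrder (sigmaEnd p δ) (genField p y l)
        (normalOrder (sigmaEnd p ε) (genField p x k) B) := by
  subst hε hδ
  refine normalOrder_comm _ _ _ _ _ _ (sgn_mul_self _) (sigmaEnd_comm _ _) ?_ ?_ ?_ ?_
  · intro n
    rw [genField, ncoeff_ofModes, sigmaEnd_genMode]
  · intro n
    rw [genField, ncoeff_ofModes, sigmaEnd_genMode, mul_comm]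
  · intro i j
    rw [genField, genField, ncoeff_ofModes, ncoeff_ofModes, genMode_neg_comm]
  · intro i j
    rw [genField, genField, ncoeff_ofModes, ncoeff_ofModes, genMode_natCast, genMode_natCast,
      annihilation_comm]

theorem superNormalOrder_comm (x y : Gen A) :
    superNormalOrder (par p x) (genField p x) * superNormalOrder (par p y) (genField p y) =
      sgn (par p x * par p y) •
        (superNormalOrder (par p y) (genField p y) *
          superNormalOrder (par p x) (genField p x)) := by
  have h1 : ∀ z : Gen A, par p z = modePar p z 1 := fun z => by
    rw [modePar, add_assoc, CharTwo.add_self_eq_zero, add_zero]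
  have h0 : ∀ z : Gen A, par p z + 1 = modePar p z 0 := fun z => by
    rw [modePar, add_zero]
  have c11 := fun B => normalOrder_genField_comm (p := p) x y 1 1 _ _ (h1 x) (h1 y) B
  have c01 := fun B => normalOrder_genField_comm (p := p) x y 0 1 _ _ (h0 x) (h1 y) B
  have c10 := fun B => normalOrder_genField_comm (p := p) x y 1 0 _ _ (h1 x) (h0 y) B
  refine LinearMap.ext fun B => funext fun k => ?_
  have hk : ∀ k : ZMod 2, k = 0 ∨ k = 1 := by decide
  rcases hk k with rfl | rfl
  · simp only [superNormalOrder, Module.End.mul_apply, LinearMap.smul_apply, LinearMap.coe_mk,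
      AddHom.coe_mk, Pi.smul_apply, zero_ne_one, if_false, if_true, map_add, map_smul, smul_add]
    rw [c11, c01, c10]
    simp only [smul_smul, ← sgn_add]
    have e1 : ∀ u v : ZMod 2, (u + 1) * v = u * v + v := by decide
    have e2 : ∀ u v : ZMod 2, u + u * (v + 1) = u * v := by decide
    have e3 : ∀ u v : ZMod 2, u + (v + u * v) = u * v + (v + u) := by decide
    rw [e1, e2, e3]
    abel
  · simp only [superNormalOrder, Module.End.mul_apply, LinearMap.smul_apply, LinearMap.coe_mk,
      AddHom.coe_mk, Pi.smul_apply, if_true]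
    rw [c11]

variable (p) in
/-- The state-field correspondence `Y` is determined by `Y(|0⟩) = id` and
`Y(:x v:) = :Y(x) Y(v):`; this is the map sending `x_1 ⋯ x_r` to `B ↦ :Y(x_1) ⋯ :Y(x_r) B::`. -/
def fieldAction : Fch p →ₐ[ℂ] Module.End ℂ (SuperField p) :=
  Fch.lift (fun x => superNormalOrder (par p x) (genField p x)) superNormalOrder_comm

variable (p) in
/-- The superfield `Y(v, z, θ)` of a vector `v`. -/
def Y (v : Fch p) : SuperField p :=
  fieldAction p v fun k => if k = 1 then identityField (Fch p) else 0

variable (p) in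
/-- The operator `v_(n|k)`, the coefficient of `z ^ (-n-1)` (if `k = 1`) or of `θ z ^ (-n-1)`
(if `k = 0`) in `Y(v, z, θ)`. -/
def mode (v : Fch p) (n : ℤ) (k : ZMod 2) : Module.End ℂ (Fch p) := ncoeff (Y p v k) n

variable (p) in
/-- The normally ordered product `:u v: = u_(-1|1) v`. -/
def nprod (u v : Fch p) : Fch p := mode p u (-1) 1 v

end

/-! ### The shifted superconformal vector, the current and the BRST operator -/

variable (p) in
/-- `φ_a`. -/
def phi (a : A) : Fch p := gen p (0, Sum.inl a)

variable (p) in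
/-- `φ^ā`. -/
def phiBar (a : A) : Fch p := gen p (0, Sum.inr a)

section

variable [Fintype A] [DecidableEq A]

variable (p) in
/-- The shifted superconformal vector. -/
def Tsh (t : A → ℂ) : Fch p :=
  ∑ a with p a = 0, ((t a + 1) • nprod p (del p (phi p a)) (phiBar p a) +
      t a • nprod p (phi p a) (del p (phiBar p a)) +
      nprod p (D p (phi p a)) (D p (phiBar p a))) +
    ∑ a with p a = 1, (t a • nprod p (del p (phi p a)) (phiBar p a) +
      (t a + 1) • nprod p (phi p a) (del p (phiBar p a)) +
      nprod p (D p (phi p a)) (D p (phiBar p a)))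

variable (p) in
/-- The standard current. -/
def Jst : Fch p :=
  ∑ a with p a = 0, nprod p (D p (phi p a)) (phiBar p a) +
    ∑ a with p a = 1, nprod p (D p (phiBar p a)) (phi p a)

variable (p) in
/-- The ghost term of the current. -/
def Jghost (t : A → ℂ) : Fch p :=
  ∑ a with p a = 0, t a • (nprod p (D p (phi p a)) (phiBar p a) +
      nprod p (phi p a) (D p (phiBar p a))) +
    ∑ a with p a = 1, t a • (nprod p (D p (phiBar p a)) (phi p a) +
      nprod p (phiBar p a) (D p (phi p a)))

variable (p) in
/-- The shifted current. -/
def Jsh (t : A → ℂ) : Fch p := Jst p + Jghost p t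

variable (p) in
/-- The vector `d = ∑ D φ_a D φ^ā`. -/
def dVec : Fch p := ∑ a, nprod p (D p (phi p a)) (D p (phiBar p a))

variable (p) in
/-- The BRST operator `Q = (T_(0|1) - J_(0|0)) / 2`. -/
def brst (t : A → ℂ) : Module.End ℂ (Fch p) :=
  (1 / 2 : ℂ) • (mode p (Tsh p t) 0 1 - mode p (Jsh p t) 0 0)

end

end

end SUSYFermion

end

noncomputable section

namespace SUSYFermion

/-! ### Normally ordered products -/

/-! Since `(D v)_(n|1) = v_(n|0)`, the BRST operator is half of `(T - D J)_(0|1)`, so the first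
claim reduces to the identity of vectors `T - D J = 2 d` (`Tsh_sub_D_Jsh`). In it, `D` of the ghost
term of `J` cancels the whole `t`-part of `T`. The remaining part of `D J` contains `D φ_a D φ^ā`
with sign `-1`, whence the factor 2.

For `Q ^ 2 = 0`, call `i` the level of the generators `D ^ i φ_a`, `D ^ i φ^ā`. The vector `d` is a
sum of products `x y` of two generators of level 1. In the zero mode of such a product every term is
a creation operator of one factor times an annihilation operator of the other. The creation
operators multiply by generators of odd level. The annihilation operators read off the
`χ`-coefficient of a bracket, and between two odd levels this coefficient vanishes
(`bracket_level`), because each `D` exchanges the two components of the bracket.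

Hence `Q` is an odd superderivation which kills generators of odd level and sends all others into
the span of those (`isLevelDer_mode_dVec`). Such an operator squares to zero
(`IsLevelDer.mul_self`): `Q ^ 2` vanishes on generators, and in `Q ^ 2 (y v)` the two cross terms
`Q(y) Q(v)` carry opposite signs. No double contraction has to be computed. -/

theorem ncoeff_normalOrder_zero {V : Type*} [AddCommGroup V] [Module ℂ V]
    (s : Module.End ℂ V) (a B : VertexOperator ℂ V) :
    ncoeff (normalOrder s a B) 0 =
      locSum _ (creation_finite a B 0) + locSum _ (annihilation_finite s a B 0) := by
  change ncoeff (creationPart a B + annihilationPart s a B) 0 = _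
  rw [map_add, Pi.add_apply, creationPart, annihilationPart, ncoeff_ofModes, ncoeff_ofModes]

theorem ncoeff_identityField {V : Type*} [AddCommGroup V] [Module ℂ V] (n : ℤ) :
    ncoeff (identityField V) n = if n = -1 then 1 else 0 := by
  rw [identityField, ncoeff_ofModes]

theorem normalOrder_identityField {V : Type*} [AddCommGroup V] [Module ℂ V] (s : Module.End ℂ V)
    (hs : s * s = 1) (a : VertexOperator ℂ V) : normalOrder s a (identityField V) = a := by
  refine field_ext fun n v => ?_
  change ncoeff (creationPart a _ + annihilationPart s a _) n v = _
  rw [map_add, Pi.add_apply, LinearMap.add_apply, ncoeff_creationPart, ncoeff_annihilationPart]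
  simp only [ncoeff_identityField]
  -- The identity field has only the mode `-1`. For `n ≥ 0` this leaves the annihilation term `j =
  -- n`, conjugated by `s`, which is where `s * s = 1` enters; for `n = -m-1` it leaves the creation
  -- term `j = m`.
  rcases n with n | m
  · have e : ∀ j : ℕ, ¬ (Int.ofNat n + (j : ℤ) = -1) := fun j => by
      simp only [Int.ofNat_eq_natCast]; omega
    rw [finsum_eq_zero_of_forall_eq_zero fun j => by rw [if_neg (e j)]; simp, zero_add,
      finsum_eq_single _ n fun j hj => by
        rw [if_neg (by simp only [Int.ofNat_eq_natCast]; omega)]; simp]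
    rw [if_pos (by simp only [Int.ofNat_eq_natCast]; omega), mul_one, hs, one_mul]
    rfl
  · rw [finsum_eq_single _ m fun j hj => by rw [if_neg (by omega)]; simp,
      finsum_eq_zero_of_forall_eq_zero fun j => by rw [if_neg (by omega)]; simp, add_zero,
      if_pos (by omega), mul_one, show -(m : ℤ) - 1 = Int.negSucc m by omega]

/-! ### The parity operator and the derivation `D` on monomials -/

variable {A : Type*} {p : A → ZMod 2}

theorem sigmaEnd_mul_self (ε : ZMod 2) : sigmaEnd p ε * sigmaEnd p ε = 1 := by
  refine Fch.linearMap_ext (by simp [sigmaEnd_one]) fun x v h => ?_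
  simp only [Module.End.mul_apply, Module.End.one_apply] at h ⊢
  rw [sigmaEnd_gen_mul, map_smul, sigmaEnd_gen_mul, smul_smul, sgn_mul_self, one_smul, h]

theorem D_gen (x : Gen A) : D p (gen p x) = gen p (x.shift 1) := superDer_gen ..

theorem D_gen_mul (x : Gen A) (v : Fch p) :
    D p (gen p x * v) = gen p (x.shift 1) * v + sgn (par p x) • (gen p x * D p v) := by
  rw [D, superDer_gen_mul, one_mul]

theorem D_one : D p 1 = 0 := superDer_one ..

section

variable [DecidableEq A]

/-! ### The superfield of `D v` -/

/-- The recursion for `bracket` strips the right exponent first, so sesquilinearity on the left is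
built in only at `j = 0`. It propagates because `χ` and `D + χ` anticommute on multiples of the
vacuum, and the sign `(-1) ^ (x + 1)` flips when `x` becomes `D x`. -/
theorem bracket_succ_left (p : A → ZMod 2) (g h : A ⊕ A) (i j : ℕ) :
    bracket p g h (i + 1) j = chiMul (bracket p g h i j) := by
  induction j with
  | zero => rw [bracket]
  | succ j ih =>
    have e : par p (i + 1, g) = par p (i, g) + 1 := par_shift p 1 (i, g)
    rw [bracket, bracket, ih, e, sgn_add _ 1, sgn_one]
    ext : 1 <;> simp [chiMul, dChiMul]

/-- Multiplication by `χ` moves the `χ`-free component of the bracket into the `χ`-component. -/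
theorem contraction_shift (x y : Gen A) (n : ℕ) :
    contraction p (x.shift 1) y n 1 = contraction p x y n 0 := by
  simp [contraction, Gen.shift, bracket_succ_left, chiMul]

theorem annihilation_shift (x : Gen A) (n : ℕ) :
    annihilation p (x.shift 1) n 1 = annihilation p x n 0 := by
  refine Fch.linearMap_ext (by simp only [annihilation_one]) fun y v h => ?_
  rw [annihilation_gen_mul, annihilation_gen_mul, h, contraction_shift, modePar, modePar,
    par_shift]
  congr 4
  rw [Nat.cast_one, add_assoc, add_assoc, add_zero, CharTwo.add_self_eq_zero, add_zero]

theorem genMode_shift (x : Gen A) (n : ℤ) : genMode p (x.shift 1) 1 n = genMode p x 0 n := by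
  rcases n with n | m
  · exact annihilation_shift x n
  · have e : (x.shift 1).shift (2 * m) = x.shift (2 * m + 1) := by
      simp only [Gen.shift]; congr 1; ring
    simp [genMode, e]

theorem genField_shift (x : Gen A) : genField p (x.shift 1) 1 = genField p x 0 :=
  field_ext fun n v => by
    rw [genField, genField, ncoeff_ofModes, ncoeff_ofModes, genMode_shift]

/-! ### Superfields of monomials and of their derivatives -/

theorem Y_one (k : ZMod 2) : Y p 1 k = if k = 1 then identityField (Fch p) else 0 := by
  simp [Y]

theorem Y_add (u v : Fch p) : Y p (u + v) = Y p u + Y p v := by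
  simp [Y]

theorem Y_smul (r : ℂ) (v : Fch p) : Y p (r • v) = r • Y p v := by
  simp [Y]

theorem Y_gen_mul (x : Gen A) (v : Fch p) :
    Y p (gen p x * v) = superNormalOrder (par p x) (genField p x) (Y p v) := by
  rw [Y, map_mul, fieldAction, Fch.lift_gen]
  rfl

theorem Y_gen_mul_apply_one (x : Gen A) (v : Fch p) :
    Y p (gen p x * v) 1 = normalOrder (sigmaEnd p (par p x)) (genField p x 1) (Y p v 1) := by
  rw [Y_gen_mul]; rfl

theorem Y_gen_mul_apply_zero (x : Gen A) (v : Fch p) :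
    Y p (gen p x * v) 0 = normalOrder (sigmaEnd p (par p x + 1)) (genField p x 0) (Y p v 1) +
      sgn (par p x) • normalOrder (sigmaEnd p (par p x)) (genField p x 1) (Y p v 0) := by
  rw [Y_gen_mul]; rfl

theorem Y_gen_apply_one (x : Gen A) : Y p (gen p x) 1 = genField p x 1 := by
  rw [← mul_one (gen p x), Y_gen_mul_apply_one, Y_one, if_pos rfl,
    normalOrder_identityField _ (sigmaEnd_mul_self _)]

variable (p) in
/-- The component `Y(v, z, θ)` at `k`, as a linear map. -/
def YLinear (k : ZMod 2) : Fch p →ₗ[ℂ] VertexOperator ℂ (Fch p) where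
  toFun v := Y p v k
  map_add' u v := by rw [Y_add, Pi.add_apply]
  map_smul' r v := by rw [Y_smul, Pi.smul_apply, RingHom.id_apply]

variable (p) in
/-- The map `v ↦ v_(n|k)`, as a linear map. -/
def modeLinear (n : ℤ) (k : ZMod 2) : Fch p →ₗ[ℂ] Module.End ℂ (Fch p) :=
  LinearMap.proj n ∘ₗ ncoeff ∘ₗ YLinear p k

theorem modeLinear_apply (n : ℤ) (k : ZMod 2) (v : Fch p) : modeLinear p n k v = mode p v n k :=
  rfl

/-- The `θ`-component of a normally ordered product obeys the same signed Leibniz rule as `D`, so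
induction on monomials reduces the claim to generators, which is `genField_shift`. -/
theorem Y_D_apply_one (v : Fch p) : Y p (D p v) 1 = Y p v 0 := by
  refine Fch.induction (LinearMap.eqLocus (YLinear p 1 ∘ₗ D p) (YLinear p 0)) ?_ ?_ v
  · change Y p (D p 1) 1 = Y p 1 0
    rw [D_one, Y_one, if_neg zero_ne_one]
    exact map_zero (YLinear p 1)
  · intro x w (hw : Y p (D p w) 1 = Y p w 0)
    change Y p (D p (gen p x * w)) 1 = Y p (gen p x * w) 0
    rw [D_gen_mul, Y_add, Y_smul, Pi.add_apply, Pi.smul_apply, Y_gen_mul_apply_one,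
      Y_gen_mul_apply_one, Y_gen_mul_apply_zero, genField_shift, hw, par_shift, Nat.cast_one]

theorem mode_D_one (v : Fch p) (n : ℤ) : mode p (D p v) n 1 = mode p v n 0 := by
  rw [mode, mode, Y_D_apply_one]

/-- This turns the normally ordered products in `T`, `J` and `d` into products in the
supercommutative algebra. -/
theorem nprod_gen (x : Gen A) (v : Fch p) : nprod p (gen p x) v = gen p x * v := by
  have e : x.shift (2 * 0 + if (1 : ZMod 2) = 0 then 1 else 0) = x := by
    rw [if_neg one_ne_zero]; rfl
  change ncoeff (Y p (gen p x) 1) (Int.negSucc 0) v = _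
  rw [Y_gen_apply_one, genField, ncoeff_ofModes, genMode, e]
  simp

/-! ### The vector of the BRST operator -/

section

variable [Fintype A]

theorem dVec_eq : dVec p = ∑ a, gen p (1, Sum.inl a) * gen p (1, Sum.inr a) :=
  Finset.sum_congr rfl fun a _ => by
    rw [phi, phiBar, D_gen, D_gen]
    exact nprod_gen _ _

theorem Tsh_sub_D_Jsh (t : A → ℂ) : Tsh p t - D p (Jsh p t) = (2 : ℂ) • dVec p := by
  have hp : ∀ k : ZMod 2, k = 0 ∨ k = 1 := by decide
  rw [Tsh, Jsh, Jst, Jghost, dVec]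
  simp only [Finset.sum_filter, ← Finset.sum_add_distrib, map_sum, Finset.smul_sum,
    ← Finset.sum_sub_distrib]
  refine Finset.sum_congr rfl fun a _ => ?_
  simp only [phi, phiBar, del, Module.End.mul_apply, D_gen, nprod_gen, Gen.shift, zero_add,
    one_add_one_eq_two]
  -- For odd `a` the current has `φ^ā` on the left, unlike `T` and `d`. These relations reorder the
  -- factors; no sign appears, since one factor in each pair is then even.
  have c1 := gen_mul_gen (p := p) (2, Sum.inr a) (0, Sum.inl a)
  have c2 := gen_mul_gen (p := p) (0, Sum.inr a) (2, Sum.inl a)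
  have c3 := gen_mul_gen (p := p) (1, Sum.inr a) (1, Sum.inl a)
  rcases hp (p a) with h | h
  · simp [h, D_gen_mul, D_gen, Gen.shift, par, sgn_zero, sgn_one, CharTwo.add_self_eq_zero]
    module
  · have h2 : (2 : ZMod 2) = 0 := rfl
    simp [h, par, sgn_zero, CharTwo.add_self_eq_zero, h2] at c1 c2 c3
    simp [h, D_gen_mul, D_gen, Gen.shift, par, sgn_zero, sgn_one, CharTwo.add_self_eq_zero,
      c1, c2, c3]
    module

theorem brst_eq_mode_dVec (t : A → ℂ) : brst p t = mode p (dVec p) 0 1 := by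
  rw [brst, ← mode_D_one, ← modeLinear_apply, ← modeLinear_apply, ← map_sub, Tsh_sub_D_Jsh,
    map_smul, smul_smul, modeLinear_apply]
  norm_num

end

/-! ### Square-zero odd superderivations -/

/-- The bracket starts from a constant, and each of the `i + j` applications of `χ` or `D + χ`
exchanges the two components. -/
theorem bracket_level (p : A → ZMod 2) (g h : A ⊕ A) (i j : ℕ) :
    (Odd (i + j) → (bracket p g h i j).1 = 0) ∧ (Even (i + j) → (bracket p g h i j).2 = 0) := by
  induction j with
  | zero =>
    induction i with
    | zero => simp [bracket]
    | succ i ih =>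
      constructor
      · intro ho
        simp [bracket, chiMul, ih.2 (by grind)]
      · intro he
        simp [bracket, chiMul, ih.1 (by grind)]
  | succ j ih =>
    constructor
    · intro ho
      simp [bracket, dChiMul, ih.2 (by grind)]
    · intro he
      simp [bracket, dChiMul, ih.1 (by grind)]

theorem contraction_eq_zero_of_odd (x y : Gen A) (hx : Odd x.1) (hy : Odd y.1) (n : ℕ) :
    contraction p x y n 1 = 0 := by
  simp [contraction, (bracket_level p x.2 y.2 x.1 y.1).2 (hx.add_odd hy)]

end

theorem odd_created_one (x : Gen A) (hx : Odd x.1) (m : ℕ) : Odd (created x 1 m).1 := by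
  simp only [created, Gen.shift, if_neg one_ne_zero]
  exact hx.add_even (by simp)

variable (p) in
/-- The span of the generators `D ^ i φ_a`, `D ^ i φ^ā` with `i` odd which have parity `ε`. -/
def oddLevel (ε : ZMod 2) : Submodule ℂ (Fch p) :=
  Submodule.span ℂ {v | ∃ z : Gen A, Odd z.1 ∧ par p z = ε ∧ gen p z = v}

/-- An odd superderivation which kills the generators `D ^ i φ_a`, `D ^ i φ^ā` with `i` odd, and maps
the other generators to the span of these. -/
structure IsLevelDer (E : Module.End ℂ (Fch p)) : Prop where
  map_one : E 1 = 0
  map_gen_mul : ∀ y v, E (gen p y * v) = E (gen p y) * v + sgn (par p y) • (gen p y * E v)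
  map_gen_mem : ∀ y, E (gen p y) ∈ oddLevel p (par p y + 1)
  map_gen_odd : ∀ y : Gen A, Odd y.1 → E (gen p y) = 0

namespace IsLevelDer

theorem add {E F : Module.End ℂ (Fch p)} (hE : IsLevelDer E) (hF : IsLevelDer F) :
    IsLevelDer (E + F) where
  map_one := by simp [hE.map_one, hF.map_one]
  map_gen_mul y v := by
    simp only [LinearMap.add_apply]
    rw [hE.map_gen_mul, hF.map_gen_mul, add_mul, mul_add, smul_add]
    abel
  map_gen_mem y := (oddLevel p _).add_mem (hE.map_gen_mem y) (hF.map_gen_mem y)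
  map_gen_odd y hy := by simp [hE.map_gen_odd y hy, hF.map_gen_odd y hy]

theorem zero : IsLevelDer (0 : Module.End ℂ (Fch p)) where
  map_one := rfl
  map_gen_mul y v := by simp
  map_gen_mem y := (oddLevel p _).zero_mem
  map_gen_odd y hy := rfl

theorem sum {ι : Type*} (s : Finset ι) (E : ι → Module.End ℂ (Fch p))
    (hE : ∀ i, IsLevelDer (E i)) : IsLevelDer (∑ i ∈ s, E i) := by
  classical
  induction s using Finset.induction_on with
  | empty => exact zero
  | insert i s hi ih => rw [Finset.sum_insert hi]; exact (hE i).add ih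

/-- Every condition concerns finitely many vectors at a time, and on each vector the sum is finite.
-/
theorem locSum (E : ℕ → Module.End ℂ (Fch p))
    (hfin : ∀ v, (Function.support fun j => E j v).Finite) (hE : ∀ j, IsLevelDer (E j)) :
    IsLevelDer (SUSYFermion.locSum E hfin) where
  map_one := finsum_eq_zero_of_forall_eq_zero fun j => (hE j).map_one
  map_gen_mul y v := by
    simp only [locSum_apply]
    rw [finsum_mul' _ _ (hfin _), mul_finsum' _ _ (hfin _), smul_finsum,
      ← finsum_add_distrib]
    · exact finsum_congr fun j => (hE j).map_gen_mul y v
    · exact (hfin (gen p y)).subset fun j hj h0 => hj (by simp [h0])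
    · exact (hfin v).subset fun j hj h0 => hj (by simp [h0])
  map_gen_mem y := finsum_induction _ (oddLevel p _).zero_mem (fun _ _ => (oddLevel p _).add_mem)
    fun j => (hE j).map_gen_mem y
  map_gen_odd y hy := finsum_eq_zero_of_forall_eq_zero fun j => (hE j).map_gen_odd y hy

theorem map_mul_of_mem {E : Module.End ℂ (Fch p)} (hE : IsLevelDer E) {ε : ZMod 2} {u : Fch p}
    (hu : u ∈ oddLevel p ε) (v : Fch p) : E (u * v) = sgn ε • (u * E v) := by
  induction hu using Submodule.span_induction with
  | mem u hu =>
    obtain ⟨z, hz, rfl, rfl⟩ := hu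
    rw [hE.map_gen_mul, hE.map_gen_odd z hz, zero_mul, zero_add]
  | zero => simp
  | add u w _ _ h1 h2 => rw [add_mul, map_add, h1, h2, add_mul, smul_add]
  | smul r u _ h => rw [smul_mul_assoc, map_smul, h, smul_mul_assoc, smul_comm]

/-- In `E (E (y v))` the term `E(y) v` contributes `(-1) ^ (y + 1) E(y) E(v)`, because `E(y)` is
killed by `E` and has parity opposite to `y`. The term `(-1) ^ y y E(v)` contributes `(-1) ^ y E(y)
E(v)`, which cancels it, and a multiple of `y E(E(v))`, which vanishes by induction. -/
theorem mul_self {E : Module.End ℂ (Fch p)} (hE : IsLevelDer E) : E * E = 0 := by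
  refine Fch.linearMap_ext (by simp [hE.map_one]) fun y v h => ?_
  simp only [Module.End.mul_apply, LinearMap.zero_apply] at h ⊢
  rw [hE.map_gen_mul, map_add, map_smul, hE.map_gen_mul, hE.map_mul_of_mem (hE.map_gen_mem y), h,
    sgn_add, sgn_one, mul_zero, smul_zero, add_zero, ← add_smul]
  simp

end IsLevelDer

/-! ### Zero modes of quadratic vectors of odd level -/

section

variable [DecidableEq A]

theorem annihilation_gen (x y : Gen A) (n : ℕ) (k : ZMod 2) :
    annihilation p x n k (gen p y) = algebraMap ℂ _ (contraction p x y n k) :=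
  superDer_gen ..

/-- In a supercommutative algebra, `z` times a superderivation is again one, with the parities
added; `h` makes the result odd. Its values on generators are multiples of `z`. -/
theorem isLevelDer_mulLeft_annihilation (r : ℂ) (x z : Gen A) (hx : Odd x.1) (hz : Odd z.1)
    (h : par p z + par p x = 1) (n : ℕ) :
    IsLevelDer (r • (LinearMap.mulLeft ℂ (gen p z) * annihilation p x n 1)) where
  map_one := by simp [annihilation_one]
  map_gen_mul y v := by
    have e : modePar p x 1 = par p x := by
      rw [modePar, add_assoc, CharTwo.add_self_eq_zero, add_zero]
    simp only [LinearMap.smul_apply, Module.End.mul_apply, LinearMap.mulLeft_apply]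
    rw [annihilation_gen_mul, annihilation_gen, ← Algebra.commutes, ← Algebra.smul_def, mul_add,
      mul_smul_comm, mul_smul_comm, ← mul_assoc, gen_mul_gen, e, smul_mul_assoc, smul_smul,
      ← sgn_add, ← add_mul, add_comm (par p x), h, one_mul, smul_add, mul_smul_comm, mul_assoc,
      smul_mul_assoc, smul_mul_assoc, smul_comm r (sgn _)]
  map_gen_mem y := by
    simp only [LinearMap.smul_apply, Module.End.mul_apply, LinearMap.mulLeft_apply]
    rw [annihilation_gen, ← Algebra.commutes, ← Algebra.smul_def]
    refine Submodule.smul_mem _ _ ?_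
    by_cases hc : contraction p x y n 1 = 0
    · simp [hc]
    · refine Submodule.smul_mem _ _ (Submodule.subset_span ⟨z, hz, ?_, rfl⟩)
      -- A nonzero contraction forces `y` to have the parity of `x`, so `z` has the parity opposite
      -- to `y`.
      rw [par_of_contraction_ne_zero p x y n 1 hc, ← h]
      generalize par p z = u, par p x = w
      revert u w; decide
  map_gen_odd y hy := by
    simp [annihilation_gen, contraction_eq_zero_of_odd x y hx hy]

theorem ncoeff_genField (x : Gen A) (k : ZMod 2) (n : ℤ) :
    ncoeff (genField p x k) n = genMode p x k n := ncoeff_ofModes ..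

/-- The zero mode is `∑ x_(-j-1|1) y_(j|1)` plus, up to sign, `∑ y_(-j-1|1) x_(j|1)`, both over `j ≥
0`. The index 0 excludes terms with two creation or two annihilation operators, so each term has the
shape treated in `isLevelDer_mulLeft_annihilation`. -/
theorem isLevelDer_mode_gen_mul_gen (x y : Gen A) (hx : Odd x.1) (hy : Odd y.1)
    (h : par p x + par p y = 1) : IsLevelDer (mode p (gen p x * gen p y) 0 1) := by
  have e : ∀ x, modePar p x 1 = par p x := fun x => by
    rw [modePar, add_assoc, CharTwo.add_self_eq_zero, add_zero]
  rw [mode, Y_gen_mul_apply_one, Y_gen_apply_one, ncoeff_normalOrder_zero]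
  refine (IsLevelDer.locSum _ _ fun j => ?_).add (IsLevelDer.locSum _ _ fun j => ?_)
  · rw [ncoeff_genField, ncoeff_genField, zero_add, genMode_natCast, genMode_neg, smul_mul_assoc]
    exact isLevelDer_mulLeft_annihilation _ _ _ hy (odd_created_one x hx j)
      (by rw [par_created, e, h]) j
  -- Conjugation by the parity operator only contributes the Koszul sign of exchanging `x` and `y`,
  -- which is absorbed into the scalar.
  · have : sigmaEnd p (par p x) * genMode p y 1 (-(j : ℤ) - 1) * sigmaEnd p (par p x) =
        sgn (par p x * par p y) • genMode p y 1 (-(j : ℤ) - 1) := by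
      rw [sigmaEnd_genMode, smul_mul_assoc, mul_assoc, sigmaEnd_mul_self, mul_one, e]
    rw [ncoeff_genField, ncoeff_genField, zero_sub, this, genMode_natCast, genMode_neg, smul_smul,
      smul_mul_assoc]
    exact isLevelDer_mulLeft_annihilation _ _ _ hx (odd_created_one y hy j)
      (by rw [par_created, e, add_comm, h]) j

theorem isLevelDer_mode_dVec [Fintype A] : IsLevelDer (mode p (dVec p) 0 1) := by
  rw [dVec_eq, ← modeLinear_apply, map_sum]
  refine IsLevelDer.sum _ _ fun a => isLevelDer_mode_gen_mul_gen _ _ odd_one odd_one ?_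
  simp only [par]
  generalize p a = u
  revert u; decide

end

end SUSYFermion

end

theorem propositionB2 {A : Type*} [Fintype A] [DecidableEq A] (p : A → ZMod 2) (t : A → ℂ) :
    SUSYFermion.brst p t = SUSYFermion.mode p (SUSYFermion.dVec p) 0 1 ∧
      ∀ v : SUSYFermion.Fch p, SUSYFermion.brst p t (SUSYFermion.brst p t v) = 0 := by
  refine ⟨SUSYFermion.brst_eq_mode_dVec t, fun v => ?_⟩
  rw [SUSYFermion.brst_eq_mode_dVec]
  exact LinearMap.congr_fun SUSYFermion.isLevelDer_mode_dVec.mul_self v
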